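/- Let $Q=(q_{ij})_{i,j\ge 0}$ be the generator of a skip-free process on $\{0,1,2,\dots\}$: $q_{ij}\ge 0$ for $i\ne j$, $q_{i,i+1}>0$, $q_{ij}=0$ for $j>i+1$, and $\sum_{j=0}^{i+1}q_{ij}=0$ for all $i\ge 0$. Let $\{X_t\}_{t\ge 0}$ be a Markov process with generator $Q$ started at $0$, described by its jump chain and holding times: the successive states $Y_0=0,Y_1,Y_2,\dots$ form a Markov chain with transition probabilities $p_{xy}=-q_{xy}/q_{xx}$ for $x\ne y$ and $p_{xx}=0$; given $\{Y_k\}_{k\ge 0}$, the holding times are independent, the $k$-th one being exponential with rate $-q_{Y_kY_k}$. (The values of $X$ after a possible explosion are irrelevant.) For $n\ge 0$ let $T_n=\inf\{t\ge 0: X_t=n\}$, let $l_{T_n}^i=\int_0^{T_n}1_{\{X_s=i\}}\,ds$ for $0\le i\le n-1$ be the occupation time of state $i$ before $T_n$, and let $Q_n=(q_{ij})_{0\le i,j\le n-1}$. If $Q_n$ is tridiagonal, that is, $q_{ij}=0$ whenever $0\le i,j\le n-1$ and $|i-j|>1$, then $\{l_{T_n}^i\}_{0\le i\le n-1}$ has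 the Markov property: for every $1\le k\le n-1$, the conditional distribution of $l_{T_n}^k$ given $(l_{T_n}^{k-1},l_{T_n}^{k-2},\dots,l_{T_n}^0)$ is almost surely equal to its conditional distribution given $l_{T_n}^{k-1}$. -/

import Mathlib

open MeasureTheory ProbabilityTheory
open scoped NNReal ENNReal

/-- `Q = (q_{ij})` is the generator of a skip-free process on `{0, 1, 2, …}`: off-diagonal entries
are non-negative, `q_{i,i+1} > 0`, `q_{ij} = 0` for `j > i + 1`, and every row sums to zero. In
particular `q_{ii} < 0` for every `i`, so there are no absorbing states. -/
structure IsSkipFreeGenerator (Q : Matrix ℕ ℕ ℝ) : Prop where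
  nonneg : ∀ i j, i ≠ j → 0 ≤ Q i j
  up_pos : ∀ i, 0 < Q i (i + 1)
  skip_free : ∀ i j, i + 1 < j → Q i j = 0
  row_sum : ∀ i, ∑ j ∈ Finset.range (i + 2), Q i j = 0

/-- The upper left `n × n` submatrix `Q_n` of `Q`. -/
def upperLeft (Q : Matrix ℕ ℕ ℝ) (n : ℕ) : Matrix (Fin n) (Fin n) ℝ :=
  Q.submatrix Fin.val Fin.val

/-- All entries off the main diagonal and the two adjacent diagonals vanish. -/
def IsTridiagonal {n : ℕ} (M : Matrix (Fin n) (Fin n) ℝ) : Prop :=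
  ∀ i j : Fin n, (i : ℕ) + 1 < j ∨ (j : ℕ) + 1 < i → M i j = 0

/-- One-step transition probabilities of the embedded chain: `p_{xy} = -q_{xy} / q_{xx}` for
`x ≠ y`, and `p_{xx} = 0`. -/
noncomputable def jumpProb (Q : Matrix ℕ ℕ ℝ) (x y : ℕ) : ℝ :=
  if x = y then 0 else -Q x y / Q x x

/-- `X` is a Markov process on `{0, 1, 2, …}` with generator `Q` (without absorbing states),
started at `x₀`, in the jump chain / holding time description. There are random variables `Y k`
(successive states) and `W k` (holding times) such that `Y` is a discrete time Markov chain started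
at `x₀` with transition probabilities `jumpProb Q`, conditionally on `Y` the `W k` are independent
and exponential with rates `-q_{Y_k Y_k}`, and almost surely `X` is equal to `Y k` on
`[S k, S (k + 1))`, where `S k = W 0 + ⋯ + W (k - 1)` is the time of the `k`-th transition. The
values of `X` after the explosion time `sup S k`, if it is finite, are unrestricted. -/
def IsMarkovJumpProcess {Ω : Type*} [MeasurableSpace Ω] (P : Measure Ω)
    (Q : Matrix ℕ ℕ ℝ) (x₀ : ℕ) (X : ℝ≥0 → Ω → ℕ) : Prop :=
  (∀ t, Measurable (X t)) ∧
  ∃ (Y : ℕ → Ω → ℕ) (W : ℕ → Ω → ℝ),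
    (∀ k, Measurable (Y k)) ∧ (∀ k, Measurable (W k)) ∧
    (∀ (k : ℕ) (y : ℕ → ℕ) (B : ℕ → Set ℝ), (∀ i, MeasurableSet (B i)) →
      P {ω | ∀ i ≤ k, Y i ω = y i ∧ W i ω ∈ B i} =
        (if y 0 = x₀ then 1 else 0) *
          (∏ i ∈ Finset.range k, ENNReal.ofReal (jumpProb Q (y i) (y (i + 1)))) *
          ∏ i ∈ Finset.range (k + 1), expMeasure (-Q (y i) (y i)) (B i)) ∧
    ∀ᵐ ω ∂P, ∀ (k : ℕ) (t : ℝ≥0),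
      ∑ i ∈ Finset.range k, W i ω ≤ t → t < ∑ i ∈ Finset.range (k + 1), W i ω → X t ω = Y k ω

/-- `T_n`: the first time at which the path is in state `n` (`∞` if there is none). -/
noncomputable def firstHit {Ω : Type*} (X : ℝ≥0 → Ω → ℕ) (n : ℕ) (ω : Ω) : ℝ≥0∞ :=
  ⨅ (t : ℝ≥0) (_ : X t ω = n), (t : ℝ≥0∞)

/-- `l_{T_n}^i`: the amount of time spent in state `i` before the first hit of `n`, that is,
`∫_0^{T_n} 1_{X_s = i} ds`. -/
noncomputable def occupationTime {Ω : Type*} (X : ℝ≥0 → Ω → ℕ) (n i : ℕ) (ω : Ω) : ℝ≥0∞ :=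
  ∫⁻ s in {s : ℝ | 0 ≤ s ∧ ENNReal.ofReal s < firstHit X n ω},
    {s : ℝ | X s.toNNReal ω = i}.indicator 1 s

/-- The finite sequence `Z 0, …, Z (n - 1)` of random variables has the Markov property: for
`1 ≤ k ≤ n - 1` the conditional law of `Z k` given `(Z 0, …, Z (k - 1))` is almost surely equal to
the conditional law of `Z k` given `Z (k - 1)`. -/
def HasMarkovProperty {Ω E : Type*} [MeasurableSpace Ω] [MeasurableSpace E]
    [StandardBorelSpace E] [Nonempty E] (P : Measure Ω) [IsFiniteMeasure P]
    (n : ℕ) (Z : ℕ → Ω → E) : Prop :=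
  (∀ i < n, AEMeasurable (Z i) P) ∧
  ∀ k, 1 ≤ k → k < n → ∀ᵐ ω ∂P,
    condDistrib (Z k) (fun ω' (j : Fin k) => Z j ω') P (fun j : Fin k => Z j ω) =
      condDistrib (Z k) (Z (k - 1)) P (Z (k - 1) ω)

/-!
Write `l^i` for `l_{T_n}^i`. Since `Q_n` is tridiagonal, the joint Laplace transform
`E exp (-∑ i, a i * l^i)` is the value at `0` of the function that is harmonic on `{0, …, n - 1}`
for the birth and death chain killed at rate `a i` in the state `i`, with boundary value `1` at `n`.
If `a` vanishes above `N`, then moving an additional killing rate `r` from `N + 1` to `N`, where it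
becomes some `γ r`, multiplies this value by a factor that does not depend on `a`: two harmonic
functions whose killing rates agree below `N` are proportional on `{0, …, N}`, and above `N` the
killing rates are the same up to the one in `N + 1`. With `δ r` for the factor, this reads
`E exp (-r * l^{N+1}) * exp (-∑ i ≤ N, a i * l^i) =`
`E δ r * exp (-γ r * l^N) * exp (-∑ i ≤ N, a i * l^i)`. Letting `a` vary, the conditional Laplace
transform of `l^{N+1}` given `l^0, …, l^N` is a function of `l^N` alone.
-/

/-! ### The Laplace transform on `[0, ∞]` -/

/-- The function `x ↦ e^{-x}` on `[0, ∞]`, with `e^{-∞} = 0`; it is the integrand of all Laplace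
transforms below. -/
noncomputable def negExp (x : ℝ≥0∞) : ℝ≥0∞ := EReal.exp (-(x : EReal))

@[simp]
lemma negExp_zero : negExp 0 = 1 := by simp [negExp]

lemma negExp_add (x y : ℝ≥0∞) : negExp (x + y) = negExp x * negExp y := by
  rw [negExp, negExp, negExp, EReal.coe_ennreal_add, ← EReal.exp_add, EReal.neg_add (by simp)
    (by simp), sub_eq_add_neg]

lemma negExp_sum {ι : Type*} (s : Finset ι) (f : ι → ℝ≥0∞) :
    negExp (∑ i ∈ s, f i) = ∏ i ∈ s, negExp (f i) := by
  induction s using Finset.cons_induction with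
  | empty => simp
  | cons i s hi ih => rw [Finset.sum_cons, Finset.prod_cons, negExp_add, ih]

lemma negExp_le_one (x : ℝ≥0∞) : negExp x ≤ 1 := by
  rw [negExp, EReal.exp_le_one_iff, EReal.neg_le, neg_zero]
  exact EReal.coe_ennreal_nonneg x

lemma negExp_ne_top (x : ℝ≥0∞) : negExp x ≠ ∞ :=
  ((negExp_le_one x).trans_lt ENNReal.one_lt_top).ne

lemma negExp_injective : Function.Injective negExp := fun x y h => by
  simpa using EReal.exp_strictMono.injective h

lemma negExp_ofReal {t : ℝ} (ht : 0 ≤ t) :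
    negExp (ENNReal.ofReal t) = ENNReal.ofReal (Real.exp (-t)) := by
  rw [negExp, EReal.coe_ennreal_ofReal, max_eq_left ht, ← EReal.coe_neg, EReal.exp_coe]

lemma continuous_negExp : Continuous negExp :=
  ENNReal.continuous_exp.comp (continuous_neg.comp continuous_coe_ennreal_ereal)

@[fun_prop]
lemma measurable_negExp : Measurable negExp := continuous_negExp.measurable

/-! ### Measures determined by a multiplicative class of functions -/

theorem measure_ext_of_forall_mem_submonoid_integral_eq {E : Type*} [MeasurableSpace E]
    [TopologicalSpace E] [PolishSpace E] [BorelSpace E] {μ ν : Measure E} [IsFiniteMeasure μ]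
    [IsFiniteMeasure ν] (S : Submonoid (BoundedContinuousFunction E ℝ))
    (hS : ∀ x y, x ≠ y → ∃ g ∈ S, g x ≠ g y) (h : ∀ g ∈ S, ∫ x, g x ∂μ = ∫ x, g x ∂ν) :
    μ = ν := by
  let A : StarSubalgebra ℝ (BoundedContinuousFunction E ℝ) :=
    { Algebra.adjoin ℝ (S : Set (BoundedContinuousFunction E ℝ)) with
      star_mem' := fun {g} hg => by rwa [show star g = g by ext x; simp] }
  refine ext_of_forall_mem_subalgebra_integral_eq_of_polish (A := A) ?_ fun g hg => ?_
  · intro x y hxy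
    obtain ⟨g, hg, hgxy⟩ := hS x y hxy
    exact ⟨g, ⟨g.toContinuousMap, ⟨g, Algebra.subset_adjoin hg, rfl⟩, rfl⟩, hgxy⟩
  have hspan : g ∈ Submodule.span ℝ (S : Set (BoundedContinuousFunction E ℝ)) := by
    rwa [← Submonoid.closure_eq S, ← Algebra.adjoin_eq_span]
  clear hg
  induction hspan using Submodule.span_induction with
  | mem g hg => exact h g hg
  | zero => simp
  | add f g _ _ hf hg =>
    simp only [BoundedContinuousFunction.coe_add, Pi.add_apply]
    rw [integral_add (f.integrable μ) (g.integrable μ), integral_add (f.integrable ν)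
      (g.integrable ν), hf, hg]
  | smul c g _ hg => simp only [BoundedContinuousFunction.coe_smul, integral_smul, hg]

theorem measure_ext_of_lintegral_negExp_eq {ι : Type*} [Fintype ι] {μ ν : Measure (ι → ℝ≥0∞)}
    [IsFiniteMeasure μ] [IsFiniteMeasure ν]
    (h : ∀ m : ι → ℕ, ∫⁻ x, negExp (∑ i, m i * x i) ∂μ = ∫⁻ x, negExp (∑ i, m i * x i) ∂ν) :
    μ = ν := by
  have hcont (m : ι → ℕ) : Continuous fun x : ι → ℝ≥0∞ => negExp (∑ i, m i * x i) :=
    continuous_negExp.comp <| continuous_finsetSum _ fun i _ =>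
      (ENNReal.continuous_const_mul (ENNReal.natCast_ne_top _)).comp (continuous_apply i)
  let S : Submonoid (BoundedContinuousFunction (ι → ℝ≥0∞) ℝ) :=
    { carrier := {g | ∃ m : ι → ℕ, ∀ x, g x = (negExp (∑ i, m i * x i)).toReal}
      one_mem' := ⟨0, fun x => by simp⟩
      mul_mem' := by
        rintro f g ⟨m, hm⟩ ⟨m', hm'⟩
        refine ⟨m + m', fun x => ?_⟩
        simp only [BoundedContinuousFunction.coe_mul, Pi.mul_apply, hm, hm', Pi.add_apply,
          Nat.cast_add, add_mul, Finset.sum_add_distrib, negExp_add, ENNReal.toReal_mul] }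
  refine measure_ext_of_forall_mem_submonoid_integral_eq S (fun x y hxy => ?_) ?_
  · classical
    obtain ⟨i, hi⟩ := Function.ne_iff.mp hxy
    refine ⟨.mkOfCompact ⟨fun x => (negExp (∑ j, (Pi.single i 1 : ι → ℕ) j * x j)).toReal,
      ENNReal.continuousOn_toReal.comp_continuous (hcont _) fun x => negExp_ne_top _⟩,
      ⟨Pi.single i 1, fun x => rfl⟩, fun hxy' => hi (negExp_injective ?_)⟩
    simpa [Pi.single_apply, ENNReal.toReal_eq_toReal_iff' (negExp_ne_top _) (negExp_ne_top _)]
      using hxy'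
  · rintro g ⟨m, hm⟩
    simp only [hm]
    rw [integral_toReal (hcont m).measurable.aemeasurable
      (.of_forall fun x => (negExp_ne_top _).lt_top), integral_toReal
      (hcont m).measurable.aemeasurable (.of_forall fun x => (negExp_ne_top _).lt_top), h]

lemma measure_ennreal_ext_of_lintegral_negExp_eq {μ ν : Measure ℝ≥0∞} [IsFiniteMeasure μ]
    [IsFiniteMeasure ν] (h : ∀ r : ℕ, ∫⁻ x, negExp (r * x) ∂μ = ∫⁻ x, negExp (r * x) ∂ν) :
    μ = ν := by
  refine (MeasurableEquiv.funUnique Unit ℝ≥0∞).symm.map_measurableEquiv_injective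
    (measure_ext_of_lintegral_negExp_eq fun m => ?_)
  rw [lintegral_map_equiv, lintegral_map_equiv]
  simpa using h (m ())

/-! ### Conditional distributions and Laplace transforms -/

lemma setLIntegral_preimage_eq_of_lintegral_mul_negExp_eq {Ω ι : Type*} [Fintype ι]
    [MeasurableSpace Ω] {P : Measure Ω} {V : Ω → ι → ℝ≥0∞} (hV : Measurable V) {F G : Ω → ℝ≥0∞}
    (hF : Measurable F) (hG : Measurable G) (hFP : ∫⁻ ω, F ω ∂P ≠ ∞) (hGP : ∫⁻ ω, G ω ∂P ≠ ∞)
    (h : ∀ m : ι → ℕ, ∫⁻ ω, F ω * negExp (∑ i, m i * V ω i) ∂P =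
      ∫⁻ ω, G ω * negExp (∑ i, m i * V ω i) ∂P)
    {A : Set (ι → ℝ≥0∞)} (hA : MeasurableSet A) :
    ∫⁻ ω in V ⁻¹' A, F ω ∂P = ∫⁻ ω in V ⁻¹' A, G ω ∂P := by
  have := isFiniteMeasure_withDensity hFP
  have := isFiniteMeasure_withDensity hGP
  have hmap : (P.withDensity F).map V = (P.withDensity G).map V :=
    measure_ext_of_lintegral_negExp_eq fun m => by
      rw [lintegral_map (by fun_prop) hV, lintegral_map (by fun_prop) hV,
        lintegral_withDensity_eq_lintegral_mul _ hF (by fun_prop),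
        lintegral_withDensity_eq_lintegral_mul _ hG (by fun_prop)]
      exact h m
  rw [← withDensity_apply _ (hV hA), ← withDensity_apply _ (hV hA), ← Measure.map_apply hV hA,
    hmap, Measure.map_apply hV hA]

section CondDistrib

variable {Ω β γ E : Type*} [MeasurableSpace Ω] [MeasurableSpace β] [MeasurableSpace γ]
  [MeasurableSpace E] [StandardBorelSpace E] [Nonempty E] {P : Measure Ω} [IsFiniteMeasure P]
  {V : Ω → β} {Z : Ω → E}

lemma lintegral_condDistrib_ae_eq (hV : Measurable V) (hZ : Measurable Z) {h : E → ℝ≥0∞}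
    (hh : Measurable h) {g : β → ℝ≥0∞} (hg : Measurable g)
    (hgh : ∀ A, MeasurableSet A → ∫⁻ ω in V ⁻¹' A, h (Z ω) ∂P = ∫⁻ ω in V ⁻¹' A, g (V ω) ∂P) :
    ∀ᵐ ω ∂P, ∫⁻ z, h z ∂condDistrib Z V P (V ω) = g (V ω) := by
  have hsnd : Measurable fun x : β × E => h x.2 := hh.comp measurable_snd
  have hlaw : (fun v => ∫⁻ z, h z ∂condDistrib Z V P v) =ᵐ[P.map V] g := by
    refine ae_eq_of_forall_setLIntegral_eq_of_sigmaFinite hh.lintegral_kernel hg fun A hA _ => ?_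
    calc ∫⁻ v in A, ∫⁻ z, h z ∂condDistrib Z V P v ∂P.map V
        = ∫⁻ x in A ×ˢ Set.univ, h x.2 ∂P.map fun ω => (V ω, Z ω) := by
          rw [← compProd_map_condDistrib hZ.aemeasurable,
            Measure.setLIntegral_compProd hsnd hA MeasurableSet.univ]
          simp only [Measure.restrict_univ]
      _ = ∫⁻ ω in V ⁻¹' A, h (Z ω) ∂P := by
          rw [setLIntegral_map (hA.prod MeasurableSet.univ) hsnd
            (hV.prodMk hZ), Set.mk_preimage_prod, Set.preimage_univ, Set.inter_univ]
      _ = ∫⁻ v in A, g v ∂P.map V := by rw [hgh A hA, setLIntegral_map hA hg hV]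
  exact ae_of_ae_map hV.aemeasurable hlaw

theorem condDistrib_ae_eq_condDistrib_comp {ι : Type*} [Countable ι] (hV : Measurable V)
    (hZ : Measurable Z) {p : β → γ} (hp : Measurable p) {h : ι → E → ℝ≥0∞}
    (hh : ∀ i, Measurable (h i))
    (hdet : ∀ (μ ν : Measure E) [IsProbabilityMeasure μ] [IsProbabilityMeasure ν],
      (∀ i, ∫⁻ z, h i z ∂μ = ∫⁻ z, h i z ∂ν) → μ = ν)
    {g : ι → γ → ℝ≥0∞} (hg : ∀ i, Measurable (g i))
    (hgh : ∀ i A, MeasurableSet A →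
      ∫⁻ ω in V ⁻¹' A, h i (Z ω) ∂P = ∫⁻ ω in V ⁻¹' A, g i (p (V ω)) ∂P) :
    ∀ᵐ ω ∂P, condDistrib Z V P (V ω) = condDistrib Z (fun ω => p (V ω)) P (p (V ω)) := by
  have hfine : ∀ᵐ ω ∂P, ∀ i, ∫⁻ z, h i z ∂condDistrib Z V P (V ω) = g i (p (V ω)) :=
    ae_all_iff.2 fun i =>
      lintegral_condDistrib_ae_eq hV hZ (hh i) ((hg i).comp hp) (hgh i)
  have hcoarse : ∀ᵐ ω ∂P, ∀ i,
      ∫⁻ z, h i z ∂condDistrib Z (fun ω => p (V ω)) P (p (V ω)) = g i (p (V ω)) :=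
    ae_all_iff.2 fun i => lintegral_condDistrib_ae_eq (hp.comp hV) hZ (hh i) (hg i)
      fun A hA => hgh i (p ⁻¹' A) (hp hA)
  filter_upwards [hfine, hcoarse] with ω hω hω'
  exact hdet _ _ fun i => (hω i).trans (hω' i).symm

end CondDistrib

theorem condDistrib_ae_eq_condDistrib_eval {Ω ι : Type*} [Fintype ι] [MeasurableSpace Ω]
    {P : Measure Ω} [IsFiniteMeasure P] {V : Ω → ι → ℝ≥0∞} {Z : Ω → ℝ≥0∞} (hV : Measurable V)
    (hZ : Measurable Z) (i₀ : ι) {g : ℕ → ℝ≥0∞ → ℝ≥0∞} (hg : ∀ r, Measurable (g r))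
    (h : ∀ (r : ℕ) (m : ι → ℕ), ∫⁻ ω, negExp (r * Z ω) * negExp (∑ i, m i * V ω i) ∂P =
      ∫⁻ ω, g r (V ω i₀) * negExp (∑ i, m i * V ω i) ∂P) :
    ∀ᵐ ω ∂P, condDistrib Z V P (V ω) = condDistrib Z (fun ω => V ω i₀) P (V ω i₀) := by
  have hfin (r : ℕ) : ∫⁻ ω, negExp (r * Z ω) ∂P ≠ ∞ :=
    ((lintegral_mono fun ω => negExp_le_one _).trans_lt (by simp)).ne
  have hfin' (r : ℕ) : ∫⁻ ω, g r (V ω i₀) ∂P ≠ ∞ := by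
    have h0 := h r 0
    simp only [Pi.zero_apply, Nat.cast_zero, zero_mul, Finset.sum_const_zero, negExp_zero,
      mul_one] at h0
    exact h0 ▸ hfin r
  exact condDistrib_ae_eq_condDistrib_comp hV hZ (measurable_pi_apply i₀)
    (h := fun (r : ℕ) z => negExp (r * z)) (fun r => by fun_prop)
    (fun μ ν _ _ => measure_ennreal_ext_of_lintegral_negExp_eq) hg fun r A hA =>
      setLIntegral_preimage_eq_of_lintegral_mul_negExp_eq hV (by fun_prop) (by fun_prop) (hfin r)
        (hfin' r) (h r) hA

/-! ### Harmonic functions of killed birth and death chains -/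

section BirthDeath

variable {K : Type*} [Field K] {b d a : ℕ → K} {n : ℕ}

/-- `h` is harmonic on `{0, …, n - 1}` for the birth and death chain with birth rates `b`, death
rates `d` and killing rates `a`. The term `d 0 * h (0 - 1)` of the row `i = 0` is the junk value
`d 0 * h 0`, so this is the usual notion if `d 0 = 0`. -/
def IsHarmonicBelow (b d a : ℕ → K) (n : ℕ) (h : ℕ → K) : Prop :=
  ∀ i < n, (b i + d i + a i) * h i = b i * h (i + 1) + d i * h (i - 1)

lemma IsHarmonicBelow.restrict {h a' : ℕ → K} {m : ℕ} (hh : IsHarmonicBelow b d a n h)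
    (hmn : m ≤ n) (ha : ∀ i < m, a i = a' i) : IsHarmonicBelow b d a' m h := fun i hi => by
  rw [← ha i hi]
  exact hh i (hi.trans_le hmn)

lemma IsHarmonicBelow.apply_mul_apply_zero {f g : ℕ → K} (hb : ∀ i < n, b i ≠ 0)
    (hf : IsHarmonicBelow b d a n f) (hg : IsHarmonicBelow b d a n g) {i : ℕ} (hi : i ≤ n) :
    f i * g 0 = g i * f 0 := by
  induction i using Nat.strong_induction_on with
  | _ i ih =>
    rcases i with _ | i
    · ring
    · have hcur := ih i (by omega) (by omega)
      have hprev := ih (i - 1) (by omega) (by omega)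
      apply mul_left_cancel₀ (hb i (by omega))
      linear_combination (b i + d i + a i) * hcur - d i * hprev - g 0 * hf i (by omega) +
        f 0 * hg i (by omega)

variable [LinearOrder K] [IsStrictOrderedRing K]

/- `β / b k` is the probability that the unkilled chain started at `k + 1` reaches `n` before
`k`. -/
lemma exists_escape_rate (hb : ∀ i, 0 < b i) (hd : ∀ i, 0 ≤ d i) {k : ℕ} (hk : k < n) :
    ∃ β, 0 < β ∧ ∀ h : ℕ → K,
      (∀ i, k < i → i < n → (b i + d i) * h i = b i * h (i + 1) + d i * h (i - 1)) →
      b k * (h (k + 1) - h k) = β * (h n - h k) := by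
  obtain ⟨n, rfl⟩ := Nat.exists_eq_add_one.2 hk.bot_lt
  induction Nat.le_of_lt_succ hk using Nat.decreasingInduction with
  | self =>
    exact ⟨b n, hb n, fun h _ => rfl⟩
  | of_succ k hkn ih =>
    obtain ⟨β, hβ, hstep⟩ := ih (by omega)
    have hpos : 0 < β + d (k + 1) := add_pos_of_pos_of_nonneg hβ (hd _)
    refine ⟨b k * β / (β + d (k + 1)), div_pos (mul_pos (hb k) hβ) hpos, fun h hh => ?_⟩
    have hescape := hstep h fun i hi hin => hh i (by omega) hin
    have hrow := hh (k + 1) (by omega) (by omega)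
    rw [Nat.add_sub_cancel] at hrow
    field_simp
    linear_combination b k * (hescape + hrow)

lemma exists_harmonic_apply_succ_eq (hb : ∀ i, 0 < b i) (hd : ∀ i, 0 ≤ d i) {k : ℕ}
    (hk : k + 1 < n) :
    ∃ β, 0 < β ∧ ∀ c h : ℕ → K, (∀ i, k + 1 < i → c i = 0) → h n = 1 →
      IsHarmonicBelow b d c n h →
      (β + d (k + 1) + c (k + 1)) * h (k + 1) = β + d (k + 1) * h k := by
  obtain ⟨β, hβ, hescape⟩ := exists_escape_rate hb hd hk
  refine ⟨β, hβ, fun c h hc hn hh => ?_⟩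
  have hrow := hh (k + 1) hk
  have hesc := hescape h fun i hi hin => by simpa [hc i hi] using hh i hin
  rw [Nat.add_sub_cancel] at hrow
  linear_combination hrow + hesc + β * hn

/- Given that `N` is visited for a total time `t`, the number of excursions from `N` to `N + 1`
that return to `N` is Poisson with mean `t * b N * d (N + 1) / θ`, and `N + 1` is visited for an
exponential time with rate `θ` in each of them and in the final one. The Laplace transform of the
total time at `N + 1` given `t` is therefore `r ↦ δ r * exp (-γ r * t)`. -/
theorem exists_harmonic_apply_zero_eq_mul (hb : ∀ i, 0 < b i) (hd : ∀ i, 0 ≤ d i) {N : ℕ}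
    (hN : N + 1 < n) :
    ∃ γ δ : K → K, ∀ r, 0 ≤ r → 0 ≤ γ r ∧ 0 ≤ δ r ∧
      ∀ a φ ψ : ℕ → K, (∀ i, N < i → a i = 0) → φ n = 1 → ψ n = 1 →
        IsHarmonicBelow b d (a + Pi.single (N + 1) r) n φ →
        IsHarmonicBelow b d (a + Pi.single N (γ r)) n ψ → φ 0 = δ r * ψ 0 := by
  obtain ⟨β, hβ, htop⟩ := exists_harmonic_apply_succ_eq hb hd hN
  set θ := β + d (N + 1)
  have hθpos : 0 < θ := add_pos_of_pos_of_nonneg hβ (hd _)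
  have hbN := hb N
  have hdN := hd (N + 1)
  refine ⟨fun r => b N * d (N + 1) * r / (θ * (θ + r)), fun r => θ / (θ + r), fun r hr =>
    ⟨by positivity, by positivity, fun a φ ψ ha hφn hψn hφ hψ => ?_⟩⟩
  set γ := b N * d (N + 1) * r / (θ * (θ + r)) with hγ
  have hφ_top : (θ + r) * φ (N + 1) = β + d (N + 1) * φ N := by
    have := htop _ φ (fun i hi => by simp [ha i (by omega), hi.ne']) hφn hφ
    rwa [Pi.add_apply, Pi.single_eq_same, ha (N + 1) (by omega), zero_add] at this
  have hψ_top : θ * ψ (N + 1) = β + d (N + 1) * ψ N := by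
    have := htop _ ψ (fun i hi => by simp [ha i (by omega), show i ≠ N by omega]) hψn hψ
    rwa [Pi.add_apply, Pi.single_eq_of_ne N.succ_ne_self, ha (N + 1) (by omega), add_zero,
      add_zero] at this
  have hφψ {i : ℕ} (hi : i ≤ N) : φ i * ψ 0 = ψ i * φ 0 :=
    (hφ.restrict (a' := a) (by omega) fun j hj => by simp [show j ≠ N + 1 by omega])
      |>.apply_mul_apply_zero (fun j _ => (hb j).ne')
      (hψ.restrict (by omega) fun j hj => by simp [hj.ne]) hi
  have hφ_row := hφ N (by omega)
  have hψ_row := hψ N (by omega)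
  simp only [Pi.add_apply, Pi.single_eq_of_ne N.succ_ne_self.symm, add_zero] at hφ_row
  simp only [Pi.add_apply, Pi.single_eq_same] at hψ_row
  have hγ_mul : γ * (θ * (θ + r)) = b N * d (N + 1) * r := by rw [hγ]; field_simp
  have hcancel : b N * β * ((θ + r) * φ 0) = b N * β * (θ * ψ 0) := by
    linear_combination θ * (θ + r) * (ψ 0 * hφ_row - φ 0 * hψ_row) + ψ N * φ 0 * hγ_mul +
      b N * θ * ψ 0 * hφ_top - b N * (θ + r) * φ 0 * hψ_top +
      (b N * θ * d (N + 1) - θ * (θ + r) * (b N + d N + a N)) * hφψ le_rfl +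
      θ * (θ + r) * d N * hφψ (N.sub_le 1)
  have := mul_left_cancel₀ (mul_pos hbN hβ).ne' hcancel
  rw [div_mul_eq_mul_div, eq_div_iff (by positivity), ← this]
  ring

end BirthDeath

/-! ### Transfer operators -/

section Transfer

variable {S : Type*}

/-- The operator `f ↦ (x ↦ ∑ z, k x z * f z)` of a non-negative kernel `k` on a discrete space; the
kernel is not assumed to be stochastic. -/
noncomputable def transferOp (k : S → S → ℝ≥0∞) (f : S → ℝ≥0∞) (x : S) : ℝ≥0∞ := ∑' z, k x z * f z

/-- The potential `∑ m, K^m f` of `f` for the transfer operator `K` of the kernel `k`. -/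
noncomputable def potential (k : S → S → ℝ≥0∞) (f : S → ℝ≥0∞) (x : S) : ℝ≥0∞ :=
  ∑' m, (transferOp k)^[m] f x

lemma transferOp_mono (k : S → S → ℝ≥0∞) : Monotone (transferOp k) := fun _ _ hfg _ =>
  ENNReal.tsum_le_tsum fun z => mul_le_mul_right (hfg z) _

lemma potential_eq_add (k : S → S → ℝ≥0∞) (f : S → ℝ≥0∞) (x : S) :
    potential k f x = f x + transferOp k (potential k f) x := by
  rw [potential, tsum_eq_zero_add' ENNReal.summable, Function.iterate_zero_apply]
  simp only [Function.iterate_succ_apply', transferOp, potential, ← ENNReal.tsum_mul_left]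
  rw [ENNReal.tsum_comm]

lemma potential_le {k : S → S → ℝ≥0∞} {f u : S → ℝ≥0∞} (h : ∀ x, f x + transferOp k u x ≤ u x) :
    potential k f ≤ u := by
  have hsum (M : ℕ) : ∀ x, ∑ m ∈ Finset.range M, (transferOp k)^[m] f x ≤ u x := by
    induction M with
    | zero => simp
    | succ M ih =>
      intro x
      calc ∑ m ∈ Finset.range (M + 1), (transferOp k)^[m] f x
          = f x + transferOp k (fun z => ∑ m ∈ Finset.range M, (transferOp k)^[m] f z) x := by
            simp only [Finset.sum_range_succ', Function.iterate_succ_apply', transferOp,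
              Finset.mul_sum, Function.iterate_zero, id_eq]
            rw [Summable.tsum_finsetSum fun _ _ => ENNReal.summable, add_comm]
        _ ≤ f x + transferOp k u x := by gcongr; exact transferOp_mono k ih x
        _ ≤ u x := h x
  exact fun x => ENNReal.tsum_le_of_sum_range_le fun M => hsum M x

lemma transferOp_iterate_eq_tsum [DecidableEq S] (k : S → S → ℝ≥0∞) (m : ℕ) (f : S → ℝ≥0∞)
    (x : S) :
    (transferOp k)^[m] f x = ∑' y : Fin (m + 1) → S,
      (if y 0 = x then 1 else 0) * (∏ i : Fin m, k (y i.castSucc) (y i.succ)) *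
        f (y (Fin.last m)) := by
  induction m generalizing f with
  | zero =>
    rw [← (Equiv.funUnique (Fin 1) S).symm.tsum_eq]
    simp
  | succ m ih =>
    rw [Function.iterate_succ_apply, ih,
      ← (Fin.snocEquiv fun _ : Fin (m + 2) => S).tsum_eq, ENNReal.tsum_prod', ENNReal.tsum_comm]
    refine tsum_congr fun y => ?_
    rw [transferOp, ← ENNReal.tsum_mul_left]
    refine tsum_congr fun z => ?_
    simp only [Fin.snocEquiv, Equiv.coe_fn_mk, Fin.prod_univ_castSucc, Fin.snoc_castSucc,
      Fin.snoc_last, ← Fin.castSucc_succ, Fin.succ_last, ← Fin.castSucc_zero (n := m + 1)]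
    ring

end Transfer

/-! ### Markov chains with independent marks -/

lemma lintegral_eq_tsum_fiber {α ι : Type*} [MeasurableSpace α] [MeasurableSpace ι] [Countable ι]
    [MeasurableSingletonClass ι] (μ : Measure α) {p : α → ι} (hp : Measurable p) (F : α → ℝ≥0∞) :
    ∫⁻ x, F x ∂μ = ∑' i, ∫⁻ x in p ⁻¹' {i}, F x ∂μ := by
  rw [← lintegral_iUnion (fun i => hp (measurableSet_singleton i))
    (fun i j hij => (Set.disjoint_singleton.2 hij).preimage p), ← Set.preimage_iUnion,
    Set.iUnion_of_singleton, Set.preimage_univ, setLIntegral_univ]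

lemma lintegral_pi_prod {ι T : Type*} [Fintype ι] [MeasurableSpace T] {ν : ι → Measure T}
    [∀ i, IsProbabilityMeasure (ν i)] {g : ι → T → ℝ≥0∞} (hg : ∀ i, Measurable (g i)) :
    ∫⁻ x, ∏ i, g i (x i) ∂Measure.pi ν = ∏ i, ∫⁻ t, g i t ∂ν i := by
  rw [lintegral_prod_eq_prod_lintegral_of_indepFun Finset.univ (fun i (x : ι → T) => g i (x i))
    (iIndepFun_pi fun i => (hg i).aemeasurable) fun i => (hg i).comp (measurable_pi_apply i)]
  exact Finset.prod_congr rfl fun i _ => (measurePreserving_eval ν i).lintegral_comp (hg i)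

/-- `Y` is a Markov chain on a discrete space started at `x₀` with transition probabilities `p`,
and given `Y` the marks `W k` are independent with laws `ν (Y k)`. -/
structure IsMarkedMarkovChain {Ω S T : Type*} [MeasurableSpace Ω] [MeasurableSpace S]
    [MeasurableSpace T] [DecidableEq S] (P : Measure Ω) (x₀ : S) (p : S → S → ℝ≥0)
    (ν : S → Measure T) (Y : ℕ → Ω → S) (W : ℕ → Ω → T) : Prop where
  measurable_state : ∀ k, Measurable (Y k)
  measurable_mark : ∀ k, Measurable (W k)
  measure_path : ∀ (k : ℕ) (y : ℕ → S) (B : ℕ → Set T), (∀ i, MeasurableSet (B i)) →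
    P {ω | ∀ i ≤ k, Y i ω = y i ∧ W i ω ∈ B i} =
      (if y 0 = x₀ then 1 else 0) * (∏ i ∈ Finset.range k, (p (y i) (y (i + 1)) : ℝ≥0∞)) *
        ∏ i ∈ Finset.range (k + 1), ν (y i) (B i)

namespace IsMarkedMarkovChain

variable {Ω S T : Type*} [MeasurableSpace Ω] [MeasurableSpace S] [MeasurableSpace T]
  [DecidableEq S] {P : Measure Ω} {x₀ : S} {p : S → S → ℝ≥0} {ν : S → Measure T}
  {Y : ℕ → Ω → S} {W : ℕ → Ω → T}

lemma measure_fin_path (h : IsMarkedMarkovChain P x₀ p ν Y W) {k : ℕ} (y : Fin (k + 1) → S)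
    {B : Fin (k + 1) → Set T} (hB : ∀ i, MeasurableSet (B i)) :
    P {ω | ∀ i : Fin (k + 1), Y i ω = y i ∧ W i ω ∈ B i} =
      (if y 0 = x₀ then 1 else 0) * (∏ i : Fin k, (p (y i.castSucc) (y i.succ) : ℝ≥0∞)) *
        ∏ i, ν (y i) (B i) := by
  have hval (i : Fin (k + 1)) : Fin.ofNat (k + 1) i = i := Fin.ofNat_val_eq_self i
  have hpath := h.measure_path k (fun i => y (Fin.ofNat (k + 1) i))
    (fun i => B (Fin.ofNat (k + 1) i)) fun i => hB _
  have hset : {ω | ∀ i : Fin (k + 1), Y i ω = y i ∧ W i ω ∈ B i} = {ω | ∀ i ≤ k,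
      Y i ω = y (Fin.ofNat (k + 1) i) ∧ W i ω ∈ B (Fin.ofNat (k + 1) i)} := by
    ext ω
    simp only [Set.mem_ofPred_eq, Fin.forall_iff, Nat.lt_succ_iff]
    refine forall₂_congr fun i hi => ?_
    rw [show Fin.ofNat (k + 1) i = ⟨i, Nat.lt_succ_of_le hi⟩ from hval ⟨i, _⟩]
  rw [hset, hpath, Finset.prod_range, Finset.prod_range]
  simp only [hval]
  congr 2
  exact Finset.prod_congr rfl fun i _ => congrArg ENNReal.ofNNReal <|
    congrArg₂ (fun i j => p (y i) (y j)) (hval i.castSucc) (hval i.succ)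

lemma map_restrict_path [∀ x, IsFiniteMeasure (ν x)]
    (h : IsMarkedMarkovChain P x₀ p ν Y W) {k : ℕ} (y : Fin (k + 1) → S) :
    (P.restrict ((fun ω (i : Fin (k + 1)) => Y i ω) ⁻¹' {y})).map
        (fun ω (i : Fin (k + 1)) => W i ω) =
      ((if y 0 = x₀ then 1 else 0) * ∏ i : Fin k, p (y i.castSucc) (y i.succ)) •
        Measure.pi fun i => ν (y i) := by
  have hW := h.measurable_mark
  have hmap : Measurable fun ω (i : Fin (k + 1)) => W i ω := by fun_prop
  let e : Fin (k + 1) → ℝ≥0 :=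
    Fin.cons (if y 0 = x₀ then 1 else 0) fun i => p (y i.castSucc) (y i.succ)
  have he : ∏ i, e i = (if y 0 = x₀ then 1 else 0) * ∏ i : Fin k, p (y i.castSucc) (y i.succ) := by
    simp only [e, Fin.prod_univ_succ, Fin.cons_zero, Fin.cons_succ]
  rw [← he]
  trans Measure.pi fun i => e i • ν (y i)
  · refine (Measure.pi_eq fun B hB => ?_).symm
    have hpre : (fun ω (i : Fin (k + 1)) => W i ω) ⁻¹' Set.univ.pi B ∩
        (fun ω (i : Fin (k + 1)) => Y i ω) ⁻¹' {y} =
        {ω | ∀ i : Fin (k + 1), Y i ω = y i ∧ W i ω ∈ B i} := by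
      ext ω
      simp [funext_iff, forall_and, and_comm]
    rw [Measure.map_apply hmap (.univ_pi hB), Measure.restrict_apply (hmap (.univ_pi hB)), hpre,
      h.measure_fin_path y hB]
    change _ = ∏ i, e i * ν (y i) (B i)
    rw [Finset.prod_mul_distrib, ← ENNReal.ofNNReal_finsetProd _ e, he]
    push_cast
    split_ifs <;> simp
  · refine Measure.pi_eq fun B _ => ?_
    change ((∏ i, e i : ℝ≥0) : ℝ≥0∞) * Measure.pi (fun i => ν (y i)) (Set.univ.pi B) =
      ∏ i, e i * ν (y i) (B i)
    rw [Measure.pi_pi, ENNReal.ofNNReal_finsetProd, Finset.prod_mul_distrib]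

lemma setLIntegral_path [MeasurableSingletonClass S] [∀ x, IsProbabilityMeasure (ν x)]
    (h : IsMarkedMarkovChain P x₀ p ν Y W) {G : S → T → ℝ≥0∞} (hG : ∀ x, Measurable (G x))
    (f : S → ℝ≥0∞) {k : ℕ} (y : Fin (k + 1) → S) :
    ∫⁻ ω in (fun ω (i : Fin (k + 1)) => Y i ω) ⁻¹' {y},
        f (Y k ω) * ∏ i ∈ Finset.range k, G (Y i ω) (W i ω) ∂P =
      (if y 0 = x₀ then 1 else 0) * (∏ i : Fin k, (p (y i.castSucc) (y i.succ) *
        ∫⁻ t, G (y i.castSucc) t ∂ν (y i.castSucc))) * f (y (Fin.last k)) := by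
  have hY := h.measurable_state
  have hW := h.measurable_mark
  let g : Fin (k + 1) → T → ℝ≥0∞ :=
    Fin.snoc (fun i => G (y i.castSucc)) fun _ => f (y (Fin.last k))
  have hg (i : Fin (k + 1)) : Measurable (g i) := by
    refine Fin.lastCases ?_ (fun i => ?_) i
    · simp [g]
    · simpa [g] using hG _
  calc ∫⁻ ω in (fun ω (i : Fin (k + 1)) => Y i ω) ⁻¹' {y},
        f (Y k ω) * ∏ i ∈ Finset.range k, G (Y i ω) (W i ω) ∂P
      = ∫⁻ ω in (fun ω (i : Fin (k + 1)) => Y i ω) ⁻¹' {y}, ∏ i, g i (W i ω) ∂P := by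
        refine setLIntegral_congr_fun (measurableSet_preimage (by fun_prop)
          (measurableSet_singleton y)) fun ω hω => ?_
        obtain rfl : (fun i : Fin (k + 1) => Y i ω) = y := hω
        simp [g, Fin.prod_univ_castSucc, Finset.prod_range, mul_comm]
    _ = ∫⁻ w, ∏ i, g i (w i) ∂(P.restrict ((fun ω (i : Fin (k + 1)) => Y i ω) ⁻¹' {y})).map
        (fun ω (i : Fin (k + 1)) => W i ω) := by
        rw [lintegral_map (by fun_prop) (by fun_prop)]
    _ = _ := by
        rw [h.map_restrict_path, lintegral_smul_measure, lintegral_pi_prod hg]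
        simp [g, Fin.prod_univ_castSucc, ENNReal.smul_def, Finset.prod_mul_distrib, mul_assoc]

theorem lintegral_mul_prod_eq_transferOp_iterate [Countable S] [MeasurableSingletonClass S]
    [∀ x, IsProbabilityMeasure (ν x)] (h : IsMarkedMarkovChain P x₀ p ν Y W) {G : S → T → ℝ≥0∞}
    (hG : ∀ x, Measurable (G x)) (f : S → ℝ≥0∞) (m : ℕ) :
    ∫⁻ ω, f (Y m ω) * ∏ i ∈ Finset.range m, G (Y i ω) (W i ω) ∂P =
      (transferOp fun x z => p x z * ∫⁻ t, G x t ∂ν x)^[m] f x₀ := by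
  have hY := h.measurable_state
  rw [transferOp_iterate_eq_tsum, lintegral_eq_tsum_fiber P
    (p := fun ω (i : Fin (m + 1)) => Y i ω) (by fun_prop)]
  exact tsum_congr fun y => h.setLIntegral_path hG f y

lemma ae_forall_mark_notMem [Countable S] (h : IsMarkedMarkovChain P x₀ p ν Y W) {s : Set T}
    (hs : MeasurableSet s) (hνs : ∀ x, ν x s = 0) : ∀ᵐ ω ∂P, ∀ k, W k ω ∉ s := by
  refine ae_all_iff.2 fun k => ?_
  have hcover : {ω | ¬ W k ω ∉ s} ⊆ ⋃ y : Fin (k + 1) → S, {ω | ∀ i : Fin (k + 1),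
      Y i ω = y i ∧ W i ω ∈ (if i = Fin.last k then s else Set.univ)} := fun ω hω =>
    Set.mem_iUnion.2 ⟨fun i => Y i ω, fun i => ⟨rfl, by split_ifs with hi <;> simp_all⟩⟩
  refine measure_mono_null hcover (measure_iUnion_null fun y => ?_)
  rw [h.measure_fin_path y fun i => by split_ifs <;> simp [hs]]
  exact mul_eq_zero_of_right _ (Finset.prod_eq_zero (Finset.mem_univ (Fin.last k))
    (by rw [if_pos rfl, hνs]))

end IsMarkedMarkovChain

/-! ### Occupation times of step functions -/

lemma exists_sum_le_lt_sum_succ {w : ℕ → ℝ} {t : ℝ} (ht : 0 ≤ t) {m : ℕ}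
    (h : t < ∑ i ∈ Finset.range m, w i) :
    ∃ k < m, ∑ i ∈ Finset.range k, w i ≤ t ∧ t < ∑ i ∈ Finset.range (k + 1), w i := by
  induction m with
  | zero => exact absurd h (by simpa using ht)
  | succ m ih =>
    rcases lt_or_ge t (∑ i ∈ Finset.range m, w i) with hlt | hge
    · obtain ⟨k, hk, hkt⟩ := ih hlt
      exact ⟨k, hk.trans m.lt_succ_self, hkt⟩
    · exact ⟨m, m.lt_succ_self, hge, h⟩

lemma setLIntegral_Ico_zero_sum {w : ℕ → ℝ} (hw : ∀ k, 0 ≤ w k) {f : ℝ → ℝ≥0∞} {c : ℕ → ℝ≥0∞}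
    (hf : ∀ k, ∀ s ∈ Set.Ico (∑ i ∈ Finset.range k, w i) (∑ i ∈ Finset.range (k + 1), w i),
      f s = c k) (m : ℕ) :
    ∫⁻ s in Set.Ico 0 (∑ i ∈ Finset.range m, w i), f s =
      ∑ k ∈ Finset.range m, c k * ENNReal.ofReal (w k) := by
  induction m with
  | zero => simp
  | succ m ih =>
    have hle : ∑ i ∈ Finset.range m, w i ≤ ∑ i ∈ Finset.range (m + 1), w i := by
      rw [Finset.sum_range_succ]
      exact le_add_of_nonneg_right (hw m)
    rw [← Set.Ico_union_Ico_eq_Ico (Finset.sum_nonneg fun i _ => hw i) hle,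
      lintegral_union measurableSet_Ico Set.Ico_disjoint_Ico_same, ih,
      setLIntegral_congr_fun measurableSet_Ico (hf m), setLIntegral_const, Real.volume_Ico,
      Finset.sum_range_succ _ m, add_sub_cancel_left, Finset.sum_range_succ _ m]

/-- The step function `x` takes the successive values `y 0, y 1, …` during successive time intervals
of lengths `w 0, w 1, …`. Its values after the time `∑ k, w k` are arbitrary. -/
def IsJumpPath (x : ℝ≥0 → ℕ) (y : ℕ → ℕ) (w : ℕ → ℝ) : Prop :=
  ∀ (k : ℕ) (t : ℝ≥0), ∑ i ∈ Finset.range k, w i ≤ t → t < ∑ i ∈ Finset.range (k + 1), w i →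
    x t = y k

/-- The sequence `y` reaches `n` at step `m`, having stayed strictly below `n` before. -/
def HitsAt (y : ℕ → ℕ) (n m : ℕ) : Prop := (∀ i < m, y i < n) ∧ y m = n

/-- The time spent in `i` by the step function with successive values `y` and holding times `w`
before its values leave `{0, …, n - 1}`. -/
noncomputable def visitTime (y : ℕ → ℕ) (w : ℕ → ℝ) (n i : ℕ) : ℝ≥0∞ :=
  ∑' k, if (∀ l ≤ k, y l < n) ∧ y k = i then ENNReal.ofReal (w k) else 0

section Measurability

variable {Ω : Type*} [MeasurableSpace Ω] {Y : ℕ → Ω → ℕ} {W : ℕ → Ω → ℝ}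

@[fun_prop]
lemma measurable_visitTime (hY : ∀ k, Measurable (Y k)) (hW : ∀ k, Measurable (W k)) (n i : ℕ) :
    Measurable fun ω => visitTime (Y · ω) (W · ω) n i :=
  Measurable.tsum fun k => Measurable.ite
    ((measurableSet_setOfPred.2 <| .forall fun l => .imp (by fun_prop) <|
      measurableSet_setOfPred.1 (hY l measurableSet_Iio)).inter (hY k (measurableSet_singleton i)))
    (hW k).ennreal_ofReal measurable_const

end Measurability

section Path

variable {Ω : Type*} {X : ℝ≥0 → Ω → ℕ} {ω : Ω} {y : ℕ → ℕ} {w : ℕ → ℝ} {n m : ℕ}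

lemma HitsAt.visitTime_eq_sum (h : HitsAt y n m) (w : ℕ → ℝ) (i : ℕ) :
    visitTime y w n i = ∑ k ∈ Finset.range m, if y k = i then ENNReal.ofReal (w k) else 0 := by
  rw [visitTime, tsum_eq_sum (s := Finset.range m)]
  · refine Finset.sum_congr rfl fun k hk => ?_
    have hbelow : ∀ l ≤ k, y l < n := fun l hl => h.1 l (hl.trans_lt (Finset.mem_range.1 hk))
    simp only [and_iff_right hbelow]
  · exact fun k hk => if_neg fun hbelow =>
      (hbelow.1 m (not_lt.1 (Finset.mem_range.not.1 hk))).ne h.2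

lemma HitsAt.sum_mul_visitTime (h : HitsAt y n m) (w : ℕ → ℝ) (a : ℕ → ℝ≥0∞) :
    ∑ x ∈ Finset.range n, a x * visitTime y w n x =
      ∑ k ∈ Finset.range m, a (y k) * ENNReal.ofReal (w k) := by
  simp only [h.visitTime_eq_sum, Finset.mul_sum, mul_ite, mul_zero]
  rw [Finset.sum_comm]
  refine Finset.sum_congr rfl fun k hk => ?_
  rw [Finset.sum_ite_eq, if_pos (Finset.mem_range.2 (h.1 k (Finset.mem_range.1 hk)))]

lemma HitsAt.firstHit_eq (h : HitsAt y n m) (hX : IsJumpPath (X · ω) y w)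
    (hw : ∀ k, 0 < w k) :
    firstHit X n ω = ENNReal.ofReal (∑ i ∈ Finset.range m, w i) := by
  have hS : 0 ≤ ∑ i ∈ Finset.range m, w i := Finset.sum_nonneg fun i _ => (hw i).le
  refine le_antisymm (iInf₂_le _ ?_) (le_iInf₂ fun t ht => ?_)
  · refine (hX m _ (Real.coe_toNNReal _ hS).ge ?_).trans h.2
    rw [Real.coe_toNNReal _ hS, Finset.sum_range_succ]
    exact lt_add_of_pos_right _ (hw m)
  · rw [ENNReal.ofReal_le_iff_le_toReal ENNReal.coe_ne_top, ENNReal.coe_toReal]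
    by_contra! hlt
    obtain ⟨k, hk, hkt⟩ := exists_sum_le_lt_sum_succ t.2 hlt
    exact (h.1 k hk).ne ((hX k t hkt.1 hkt.2).symm.trans ht)

theorem HitsAt.occupationTime_eq (h : HitsAt y n m) (hX : IsJumpPath (X · ω) y w)
    (hw : ∀ k, 0 < w k) (i : ℕ) : occupationTime X n i ω = visitTime y w n i := by
  have hset : {s : ℝ | 0 ≤ s ∧ ENNReal.ofReal s < firstHit X n ω} =
      Set.Ico 0 (∑ i ∈ Finset.range m, w i) := by
    ext s
    simp only [Set.mem_ofPred_eq, Set.mem_Ico, h.firstHit_eq hX hw]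
    exact and_congr_right fun hs => ENNReal.ofReal_lt_ofReal_iff_of_nonneg hs
  have hconst (k : ℕ) (s : ℝ)
      (hs : s ∈ Set.Ico (∑ i ∈ Finset.range k, w i) (∑ i ∈ Finset.range (k + 1), w i)) :
      {s : ℝ | X s.toNNReal ω = i}.indicator 1 s = if y k = i then (1 : ℝ≥0∞) else 0 := by
    have hs0 : (s.toNNReal : ℝ) = s :=
      Real.coe_toNNReal _ ((Finset.sum_nonneg fun i _ => (hw i).le).trans hs.1)
    have hval : X s.toNNReal ω = y k := hX k _ (hs0.symm ▸ hs.1) (hs0.symm ▸ hs.2)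
    simp only [Set.indicator_apply, Set.mem_ofPred_eq, hval, Pi.one_apply]
  rw [occupationTime, hset, setLIntegral_Ico_zero_sum (fun k => (hw k).le) hconst,
    h.visitTime_eq_sum]
  simp only [ite_mul, one_mul, zero_mul]

end Path

/-! ### Killed skip-free chains -/

lemma lintegral_negExp_mul_expMeasure {r : ℝ} (hr : 0 < r) (a : ℝ≥0) :
    ∫⁻ t, negExp (a * ENNReal.ofReal t) ∂expMeasure r = ENNReal.ofReal (r / (r + a)) := by
  have hra : 0 < r + a := by positivity
  have hpdf (s : ℝ) : Measurable (exponentialPDF s) :=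
    (measurable_exponentialPDFReal s).ennreal_ofReal
  have htilt (t : ℝ) : exponentialPDF r t * negExp (a * ENNReal.ofReal t) =
      ENNReal.ofReal (r / (r + a)) * exponentialPDF (r + a) t := by
    rw [exponentialPDF_eq, exponentialPDF_eq]
    split_ifs with ht
    · rw [← ENNReal.ofReal_coe_nnreal, ← ENNReal.ofReal_mul a.coe_nonneg,
        negExp_ofReal (by positivity), ← ENNReal.ofReal_mul (by positivity),
        ← ENNReal.ofReal_mul (by positivity), mul_assoc, ← Real.exp_add, ← mul_assoc,
        div_mul_cancel₀ _ hra.ne']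
      ring_nf
    · simp
  calc ∫⁻ t, negExp (a * ENNReal.ofReal t) ∂expMeasure r
      = ∫⁻ t, exponentialPDF r t * negExp (a * ENNReal.ofReal t) :=
        lintegral_withDensity_eq_lintegral_mul _ (hpdf r) (by fun_prop)
    _ = ENNReal.ofReal (r / (r + a)) := by
        simp only [htilt]
        rw [lintegral_const_mul _ (hpdf _), lintegral_exponentialPDF_eq_one hra, mul_one]

lemma expMeasure_Iic_zero {r : ℝ} (hr : 0 < r) : expMeasure r (Set.Iic 0) = 0 := by
  have := isProbabilityMeasure_expMeasure hr
  have h := cdf_expMeasure_eq hr 0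
  rw [cdf_eq_real] at h
  simpa [measureReal_eq_zero_iff] using h

/-- The rate of going up from `x`. -/
def upRate (Q : Matrix ℕ ℕ ℝ) (x : ℕ) : ℝ := Q x (x + 1)

/-- The rate of going down by one from `x`; it is `0` at `x = 0`. -/
def downRate (Q : Matrix ℕ ℕ ℝ) (x : ℕ) : ℝ := if x = 0 then 0 else Q x (x - 1)

/-- The factor `e^{-a_x t}` collected during a visit of length `t` to `x < n`; paths are killed
outside `{0, …, n - 1}`. -/
noncomputable def killedWeight (n : ℕ) (a : ℕ → ℝ≥0) (x : ℕ) (t : ℝ) : ℝ≥0∞ :=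
  if x < n then negExp (a x * ENNReal.ofReal t) else 0

/-- The kernel of the jump chain that is killed at rate `a x` while it stays at `x < n`, and
immediately outside `{0, …, n - 1}`. -/
noncomputable def killedKernel (Q : Matrix ℕ ℕ ℝ) (n : ℕ) (a : ℕ → ℝ≥0) (x z : ℕ) : ℝ≥0∞ :=
  (jumpProb Q x z).toNNReal * ∫⁻ t, killedWeight n a x t ∂expMeasure (-Q x x)

/-- The expectation of `exp (-∑ i, a i * l_{T_n}^i)` on the event `T_n < ∞`, as a function of the
starting point. -/
noncomputable def hitTransform (Q : Matrix ℕ ℕ ℝ) (n : ℕ) (a : ℕ → ℝ≥0) : ℕ → ℝ≥0∞ :=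
  potential (killedKernel Q n a) (Pi.single n 1)

section SkipFree

variable {Q : Matrix ℕ ℕ ℝ} {n x : ℕ}

lemma IsSkipFreeGenerator.neg_diag_pos (hQ : IsSkipFreeGenerator Q) (x : ℕ) : 0 < -Q x x := by
  have hrow := hQ.row_sum x
  rw [Finset.sum_range_succ, Finset.sum_range_succ] at hrow
  have hbelow : 0 ≤ ∑ j ∈ Finset.range x, Q x j :=
    Finset.sum_nonneg fun j hj => hQ.nonneg x j (Finset.mem_range.1 hj).ne'
  linarith [hQ.up_pos x]

lemma IsSkipFreeGenerator.upRate_pos (hQ : IsSkipFreeGenerator Q) (x : ℕ) : 0 < upRate Q x :=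
  hQ.up_pos x

lemma IsSkipFreeGenerator.downRate_nonneg (hQ : IsSkipFreeGenerator Q) (x : ℕ) :
    0 ≤ downRate Q x := by
  unfold downRate
  split_ifs with hx
  · exact le_rfl
  · exact hQ.nonneg _ _ (by omega)

lemma IsTridiagonal.apply_eq_zero (hn : IsTridiagonal (upperLeft Q n)) (hx : x < n) {z : ℕ}
    (hz : z + 1 < x) : Q x z = 0 :=
  hn ⟨x, hx⟩ ⟨z, by omega⟩ (Or.inr hz)

lemma IsSkipFreeGenerator.neg_diag_eq (hQ : IsSkipFreeGenerator Q)
    (hn : IsTridiagonal (upperLeft Q n)) (hx : x < n) :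
    -Q x x = upRate Q x + downRate Q x := by
  have hrow := hQ.row_sum x
  have hbelow : ∑ j ∈ Finset.range x, Q x j = downRate Q x := by
    rcases x with _ | x
    · simp [downRate]
    · rw [Finset.sum_range_succ, Finset.sum_eq_zero fun j hj =>
        hn.apply_eq_zero hx (Nat.succ_lt_succ (Finset.mem_range.1 hj))]
      simp [downRate]
  rw [Finset.sum_range_succ, Finset.sum_range_succ, hbelow] at hrow
  unfold upRate
  linarith

lemma jumpProb_add_one : jumpProb Q x (x + 1) = upRate Q x / -Q x x := by
  rw [jumpProb, if_neg x.succ_ne_self.symm, upRate, neg_div, div_neg]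

lemma jumpProb_sub_one : jumpProb Q x (x - 1) = downRate Q x / -Q x x := by
  rcases x with _ | x
  · simp [jumpProb, downRate]
  · rw [jumpProb, if_neg (by omega), downRate, if_neg x.succ_ne_zero, neg_div, div_neg]

lemma IsSkipFreeGenerator.jumpProb_eq_zero (hQ : IsSkipFreeGenerator Q)
    (hn : IsTridiagonal (upperLeft Q n)) (hx : x < n) {z : ℕ} (hup : z ≠ x + 1)
    (hdown : z ≠ x - 1) : jumpProb Q x z = 0 := by
  have hzero (hzx : x ≠ z) : Q x z = 0 := by
    rcases lt_or_gt_of_ne hzx with hlt | hgt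
    · exact hQ.skip_free x z (by omega)
    · exact hn.apply_eq_zero hx (by omega)
  rw [jumpProb]
  split_ifs with hzx
  · rfl
  · simp [hzero hzx]

lemma measurable_killedWeight (n : ℕ) (a : ℕ → ℝ≥0) (x : ℕ) : Measurable (killedWeight n a x) := by
  unfold killedWeight
  split_ifs <;> fun_prop

lemma transferOp_killedKernel_of_le (Q : Matrix ℕ ℕ ℝ) (a : ℕ → ℝ≥0) (hx : n ≤ x)
    (f : ℕ → ℝ≥0∞) : transferOp (killedKernel Q n a) f x = 0 := by
  simp [transferOp, killedKernel, killedWeight, hx.not_gt]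

lemma transferOp_killedKernel_of_lt (hQ : IsSkipFreeGenerator Q)
    (hn : IsTridiagonal (upperLeft Q n)) (a : ℕ → ℝ≥0) (hx : x < n) (f : ℕ → ℝ≥0∞) :
    transferOp (killedKernel Q n a) f x =
      ENNReal.ofReal (upRate Q x / (upRate Q x + downRate Q x + a x)) * f (x + 1) +
      ENNReal.ofReal (downRate Q x / (upRate Q x + downRate Q x + a x)) * f (x - 1) := by
  have hkernel (z : ℕ) {c : ℝ} (hc : 0 ≤ c) (hz : jumpProb Q x z = c / -Q x x) :
      killedKernel Q n a x z = ENNReal.ofReal (c / (upRate Q x + downRate Q x + a x)) := by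
    have hpos := hQ.neg_diag_pos x
    simp only [killedKernel, killedWeight, if_pos hx, hz]
    rw [lintegral_negExp_mul_expMeasure hpos, ← hQ.neg_diag_eq hn hx, ← ENNReal.ofReal,
      ← ENNReal.ofReal_mul (by positivity), div_mul_div_cancel₀ hpos.ne']
  rw [transferOp, tsum_eq_sum (s := {x + 1, x - 1}), Finset.sum_pair (by omega),
    hkernel _ (hQ.upRate_pos x).le jumpProb_add_one,
    hkernel _ (hQ.downRate_nonneg x) jumpProb_sub_one]
  intro z hz
  simp only [Finset.mem_insert, Finset.mem_singleton, not_or] at hz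
  simp [killedKernel, hQ.jumpProb_eq_zero hn hx hz.1 hz.2]

lemma hitTransform_self (Q : Matrix ℕ ℕ ℝ) (n : ℕ) (a : ℕ → ℝ≥0) : hitTransform Q n a n = 1 := by
  rw [hitTransform, potential_eq_add, transferOp_killedKernel_of_le Q a le_rfl, Pi.single_eq_same,
    add_zero]

lemma hitTransform_of_lt (hQ : IsSkipFreeGenerator Q) (hn : IsTridiagonal (upperLeft Q n))
    (a : ℕ → ℝ≥0) (hx : x < n) :
    hitTransform Q n a x =
      ENNReal.ofReal (upRate Q x / (upRate Q x + downRate Q x + a x)) *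
        hitTransform Q n a (x + 1) +
      ENNReal.ofReal (downRate Q x / (upRate Q x + downRate Q x + a x)) *
        hitTransform Q n a (x - 1) := by
  rw [hitTransform, potential_eq_add, transferOp_killedKernel_of_lt hQ hn a hx,
    Pi.single_eq_of_ne hx.ne, zero_add]

lemma hitTransform_le_one (hQ : IsSkipFreeGenerator Q) (hn : IsTridiagonal (upperLeft Q n))
    (a : ℕ → ℝ≥0) (x : ℕ) : hitTransform Q n a x ≤ 1 := by
  refine potential_le (u := 1) (fun x => ?_) x
  rcases lt_or_ge x n with hx | hx
  · have hb := hQ.upRate_pos x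
    have hd := hQ.downRate_nonneg x
    have hpos : 0 < upRate Q x + downRate Q x + a x :=
      add_pos_of_pos_of_nonneg (add_pos_of_pos_of_nonneg hb hd) (a x).coe_nonneg
    rw [transferOp_killedKernel_of_lt hQ hn a hx, Pi.single_eq_of_ne hx.ne]
    simp only [Pi.one_apply, mul_one, zero_add]
    rw [← ENNReal.ofReal_add (div_nonneg hb.le hpos.le) (div_nonneg hd hpos.le), ← add_div,
      ENNReal.ofReal_le_one, div_le_one hpos]
    exact le_add_of_nonneg_right (a x).coe_nonneg
  · rw [transferOp_killedKernel_of_le Q a hx, add_zero, Pi.single_apply]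
    split_ifs <;> simp

lemma hitTransform_ne_top (hQ : IsSkipFreeGenerator Q) (hn : IsTridiagonal (upperLeft Q n))
    (a : ℕ → ℝ≥0) (x : ℕ) : hitTransform Q n a x ≠ ∞ :=
  ((hitTransform_le_one hQ hn a x).trans_lt ENNReal.one_lt_top).ne

lemma isHarmonicBelow_hitTransform (hQ : IsSkipFreeGenerator Q)
    (hn : IsTridiagonal (upperLeft Q n)) (a : ℕ → ℝ≥0) :
    IsHarmonicBelow (upRate Q) (downRate Q) (fun i => a i) n
      (fun x => (hitTransform Q n a x).toReal) := fun x hx => by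
  have hb := hQ.upRate_pos x
  have hd := hQ.downRate_nonneg x
  have hpos : 0 < upRate Q x + downRate Q x + a x :=
    add_pos_of_pos_of_nonneg (add_pos_of_pos_of_nonneg hb hd) (a x).coe_nonneg
  beta_reduce
  rw [hitTransform_of_lt hQ hn a hx, ENNReal.toReal_add
    (ENNReal.mul_ne_top ENNReal.ofReal_ne_top (hitTransform_ne_top hQ hn a _))
    (ENNReal.mul_ne_top ENNReal.ofReal_ne_top (hitTransform_ne_top hQ hn a _)),
    ENNReal.toReal_mul, ENNReal.toReal_mul, ENNReal.toReal_ofReal (div_nonneg hb.le hpos.le),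
    ENNReal.toReal_ofReal (div_nonneg hd hpos.le)]
  field_simp

lemma hitTransform_zero_right (hQ : IsSkipFreeGenerator Q) (hn : IsTridiagonal (upperLeft Q n)) :
    hitTransform Q n 0 0 = 1 := by
  have hone : IsHarmonicBelow (upRate Q) (downRate Q) (fun i => ((0 : ℕ → ℝ≥0) i : ℝ)) n
      (fun _ => 1) := fun i _ => by simp
  have h := (isHarmonicBelow_hitTransform hQ hn 0).apply_mul_apply_zero
    (fun i _ => (hQ.upRate_pos i).ne') hone le_rfl
  rw [hitTransform_self, ENNReal.toReal_one, one_mul, one_mul] at h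
  rw [← ENNReal.ofReal_toReal (hitTransform_ne_top hQ hn 0 0), ← h, ENNReal.ofReal_one]

theorem exists_hitTransform_add_single_eq_mul (hQ : IsSkipFreeGenerator Q)
    (hn : IsTridiagonal (upperLeft Q n)) {N : ℕ} (hN : N + 1 < n) :
    ∃ γ δ : ℝ≥0 → ℝ≥0, ∀ (r : ℝ≥0) (a : ℕ → ℝ≥0), (∀ i, N < i → a i = 0) →
      hitTransform Q n (a + Pi.single (N + 1) r) 0 =
        δ r * hitTransform Q n (a + Pi.single N (γ r)) 0 := by
  obtain ⟨γ, δ, h⟩ := exists_harmonic_apply_zero_eq_mul (b := upRate Q) (d := downRate Q)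
    hQ.upRate_pos hQ.downRate_nonneg hN
  refine ⟨fun r => (γ r).toNNReal, fun r => (δ r).toNNReal, fun r a ha => ?_⟩
  obtain ⟨hγ, hδ, hmul⟩ := h r r.coe_nonneg
  have hcoe (j : ℕ) (s : ℝ≥0) : (fun i => ((a + Pi.single j s : ℕ → ℝ≥0) i : ℝ)) =
      (fun i => (a i : ℝ)) + Pi.single j (s : ℝ) := by
    ext i
    by_cases hi : i = j
    · subst hi; simp
    · simp [hi]
  have hφ := isHarmonicBelow_hitTransform hQ hn (a + Pi.single (N + 1) r)
  have hψ := isHarmonicBelow_hitTransform hQ hn (a + Pi.single N (γ r).toNNReal)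
  rw [hcoe] at hφ hψ
  rw [Real.coe_toNNReal _ hγ] at hψ
  have heq := hmul _ _ _ (fun i hi => by simp [ha i hi]) (by simp [hitTransform_self])
    (by simp [hitTransform_self]) hφ hψ
  rw [← ENNReal.toReal_eq_toReal_iff' (hitTransform_ne_top hQ hn _ _)
    (ENNReal.mul_ne_top ENNReal.coe_ne_top (hitTransform_ne_top hQ hn _ _)), heq,
    ENNReal.toReal_mul, ENNReal.coe_toReal, Real.coe_toNNReal _ hδ]

end SkipFree

/-! ### The law of the occupation times -/

/-- The exponential functional of a jump path whose expectation is `hitTransform`: at most one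
summand is non-zero, namely the one of the step `m` at which `n` is reached. -/
noncomputable def hitWeight (n : ℕ) (a : ℕ → ℝ≥0) (y : ℕ → ℕ) (w : ℕ → ℝ) : ℝ≥0∞ :=
  ∑' m, (Pi.single n 1 : ℕ → ℝ≥0∞) (y m) * ∏ i ∈ Finset.range m, killedWeight n a (y i) (w i)

section Path

variable {y : ℕ → ℕ} {n m : ℕ}

lemma single_mul_prod_killedWeight_eq_zero (h : ¬ HitsAt y n m) (a : ℕ → ℝ≥0) (w : ℕ → ℝ) :
    (Pi.single n 1 : ℕ → ℝ≥0∞) (y m) * ∏ i ∈ Finset.range m, killedWeight n a (y i) (w i) = 0 := by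
  by_cases hm : y m = n
  · obtain ⟨i, him, hin⟩ : ∃ i < m, n ≤ y i := by simpa [HitsAt, hm] using h
    exact mul_eq_zero_of_right _
      (Finset.prod_eq_zero (Finset.mem_range.2 him) (if_neg hin.not_gt))
  · rw [Pi.single_eq_of_ne hm, zero_mul]

lemma HitsAt.eq {m' : ℕ} (h : HitsAt y n m) (h' : HitsAt y n m') : m = m' := by
  rcases lt_trichotomy m m' with hlt | rfl | hlt
  · exact absurd h.2 (h'.1 m hlt).ne
  · rfl
  · exact absurd h'.2 (h.1 m' hlt).ne

lemma HitsAt.hitWeight_eq (h : HitsAt y n m) (a : ℕ → ℝ≥0) (w : ℕ → ℝ) :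
    hitWeight n a y w = negExp (∑ x ∈ Finset.range n, a x * visitTime y w n x) := by
  rw [hitWeight, tsum_eq_single m fun k hk =>
      single_mul_prod_killedWeight_eq_zero (fun hk' => hk (hk'.eq h)) a w,
    h.2, Pi.single_eq_same, one_mul, h.sum_mul_visitTime, negExp_sum]
  exact Finset.prod_congr rfl fun i hi => if_pos (h.1 i (Finset.mem_range.1 hi))

lemma hitWeight_eq_zero (h : ∀ m, ¬ HitsAt y n m) (a : ℕ → ℝ≥0) (w : ℕ → ℝ) :
    hitWeight n a y w = 0 :=
  ENNReal.tsum_eq_zero.2 fun m => single_mul_prod_killedWeight_eq_zero (h m) a w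

lemma hitWeight_le_one (n : ℕ) (a : ℕ → ℝ≥0) (y : ℕ → ℕ) (w : ℕ → ℝ) : hitWeight n a y w ≤ 1 := by
  by_cases h : ∃ m, HitsAt y n m
  · obtain ⟨m, hm⟩ := h
    exact hm.hitWeight_eq a w ▸ negExp_le_one _
  · exact (hitWeight_eq_zero (not_exists.1 h) a w).trans_le zero_le_one

end Path

/-- `Y` is the jump chain and `W` are the holding times of a Markov jump process with generator `Q`
started at `x₀`. -/
abbrev IsJumpChain {Ω : Type*} [MeasurableSpace Ω] (P : Measure Ω) (Q : Matrix ℕ ℕ ℝ) (x₀ : ℕ)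
    (Y : ℕ → Ω → ℕ) (W : ℕ → Ω → ℝ) : Prop :=
  IsMarkedMarkovChain P x₀ (fun x z => (jumpProb Q x z).toNNReal) (fun x => expMeasure (-Q x x)) Y W

section Law

variable {Ω : Type*} [MeasurableSpace Ω] {P : Measure Ω} {Q : Matrix ℕ ℕ ℝ} {x₀ : ℕ}
  {Y : ℕ → Ω → ℕ} {W : ℕ → Ω → ℝ} {n : ℕ}

lemma IsMarkovJumpProcess.exists_isJumpChain {X : ℝ≥0 → Ω → ℕ}
    (hX : IsMarkovJumpProcess P Q x₀ X) :
    ∃ (Y : ℕ → Ω → ℕ) (W : ℕ → Ω → ℝ), IsJumpChain P Q x₀ Y W ∧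
      ∀ᵐ ω ∂P, IsJumpPath (X · ω) (Y · ω) (W · ω) :=
  let ⟨_, Y, W, hY, hW, hpath, hjump⟩ := hX
  ⟨Y, W, ⟨hY, hW, hpath⟩, hjump⟩

namespace IsJumpChain

lemma ae_holding_pos (h : IsJumpChain P Q x₀ Y W) (hQ : IsSkipFreeGenerator Q) :
    ∀ᵐ ω ∂P, ∀ k, 0 < W k ω := by
  filter_upwards [h.ae_forall_mark_notMem measurableSet_Iic
    fun x => expMeasure_Iic_zero (hQ.neg_diag_pos x)] with ω hω k
  exact not_le.1 (hω k)

lemma measurable_prod_killedWeight (h : IsJumpChain P Q x₀ Y W) (n : ℕ) (a : ℕ → ℝ≥0) (m : ℕ) :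
    Measurable fun ω => ∏ i ∈ Finset.range m, killedWeight n a (Y i ω) (W i ω) :=
  Finset.measurable_fun_prod _ fun i _ =>
    (measurable_from_prod_countable_right (measurable_killedWeight n a) :
      Measurable fun q : ℕ × ℝ => killedWeight n a q.1 q.2).comp
      ((h.measurable_state i).prodMk (h.measurable_mark i))

lemma lintegral_hitWeight (h : IsJumpChain P Q x₀ Y W) (hQ : IsSkipFreeGenerator Q) (n : ℕ)
    (a : ℕ → ℝ≥0) :
    ∫⁻ ω, hitWeight n a (Y · ω) (W · ω) ∂P = hitTransform Q n a x₀ := by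
  have (x : ℕ) : IsProbabilityMeasure (expMeasure (-Q x x)) :=
    isProbabilityMeasure_expMeasure (hQ.neg_diag_pos x)
  have hsingle (m : ℕ) : Measurable fun ω => (Pi.single n 1 : ℕ → ℝ≥0∞) (Y m ω) :=
    measurable_from_nat.comp (h.measurable_state m)
  refine (lintegral_tsum fun m =>
    ((hsingle m).mul (h.measurable_prod_killedWeight n a m)).aemeasurable).trans ?_
  exact tsum_congr fun m =>
    h.lintegral_mul_prod_eq_transferOp_iterate (measurable_killedWeight n a) _ m

lemma ae_exists_hitsAt [IsProbabilityMeasure P] (h : IsJumpChain P Q 0 Y W)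
    (hQ : IsSkipFreeGenerator Q) (hn : IsTridiagonal (upperLeft Q n)) :
    ∀ᵐ ω ∂P, ∃ m, HitsAt (Y · ω) n m := by
  have hone : (fun ω => hitWeight n 0 (Y · ω) (W · ω)) =ᵐ[P] 1 := by
    refine ae_eq_of_ae_le_of_lintegral_le (.of_forall fun ω => hitWeight_le_one _ _ _ _)
      ?_ aemeasurable_one ?_
    · simp [h.lintegral_hitWeight hQ, hitTransform_ne_top hQ hn]
    · simp [h.lintegral_hitWeight hQ, hitTransform_zero_right hQ hn]
  filter_upwards [hone] with ω hω
  by_contra! hnot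
  exact zero_ne_one ((hitWeight_eq_zero hnot 0 _).symm.trans hω)

theorem lintegral_negExp_visitTime [IsProbabilityMeasure P] (h : IsJumpChain P Q 0 Y W)
    (hQ : IsSkipFreeGenerator Q) (hn : IsTridiagonal (upperLeft Q n)) (a : ℕ → ℝ≥0) :
    ∫⁻ ω, negExp (∑ x ∈ Finset.range n,
      a x * visitTime (Y · ω) (W · ω) n x) ∂P = hitTransform Q n a 0 := by
  rw [← h.lintegral_hitWeight hQ]
  refine lintegral_congr_ae ?_
  filter_upwards [h.ae_exists_hitsAt hQ hn] with ω ⟨m, hm⟩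
  exact (hm.hitWeight_eq a _).symm

lemma exists_lintegral_negExp_visitTime_eq [IsProbabilityMeasure P] (h : IsJumpChain P Q 0 Y W)
    (hQ : IsSkipFreeGenerator Q) (hn : IsTridiagonal (upperLeft Q n)) {N : ℕ} (hN : N + 1 < n) :
    ∃ γ δ : ℝ≥0 → ℝ≥0, ∀ (r : ℝ≥0) (a : ℕ → ℝ≥0), (∀ i, N < i → a i = 0) →
      ∫⁻ ω, negExp (r * visitTime (Y · ω) (W · ω) n (N + 1)) *
          negExp (∑ x ∈ Finset.range n,
            a x * visitTime (Y · ω) (W · ω) n x) ∂P =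
        ∫⁻ ω, δ r * negExp (γ r * visitTime (Y · ω) (W · ω) n N) *
          negExp (∑ x ∈ Finset.range n,
            a x * visitTime (Y · ω) (W · ω) n x) ∂P := by
  obtain ⟨γ, δ, hγδ⟩ := exists_hitTransform_add_single_eq_mul hQ hn hN
  refine ⟨γ, δ, fun r a ha => ?_⟩
  have hsplit {j : ℕ} (hj : j < n) (s : ℝ≥0) (l : ℕ → ℝ≥0∞) :
      negExp (s * l j) * negExp (∑ x ∈ Finset.range n, a x * l x) =
        negExp (∑ x ∈ Finset.range n, (a + Pi.single j s : ℕ → ℝ≥0) x * l x) := by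
    have hsingle : ∑ x ∈ Finset.range n, (Pi.single j s : ℕ → ℝ≥0) x * l x = s * l j := by
      rw [Finset.sum_eq_single_of_mem j (Finset.mem_range.2 hj) fun x _ hx => by simp [hx],
        Pi.single_eq_same]
    simp only [Pi.add_apply, ENNReal.coe_add, add_mul, Finset.sum_add_distrib, hsingle, negExp_add]
    exact mul_comm _ _
  have hm := measurable_visitTime h.measurable_state h.measurable_mark n
  simp only [mul_assoc, hsplit hN, hsplit (Nat.lt_of_succ_lt hN)]
  rw [lintegral_const_mul _ (by fun_prop), h.lintegral_negExp_visitTime hQ hn,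
    h.lintegral_negExp_visitTime hQ hn, hγδ r a ha]

theorem condDistrib_visitTime_ae_eq [IsProbabilityMeasure P] (h : IsJumpChain P Q 0 Y W)
    (hQ : IsSkipFreeGenerator Q) (hn : IsTridiagonal (upperLeft Q n)) {N : ℕ} (hN : N + 1 < n) :
    ∀ᵐ ω ∂P, condDistrib (fun ω' => visitTime (Y · ω') (W · ω') n (N + 1))
        (fun ω' (j : Fin (N + 1)) => visitTime (Y · ω') (W · ω') n j) P
        (fun j : Fin (N + 1) => visitTime (Y · ω) (W · ω) n j) =
      condDistrib (fun ω' => visitTime (Y · ω') (W · ω') n (N + 1))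
        (fun ω' => visitTime (Y · ω') (W · ω') n N) P (visitTime (Y · ω) (W · ω) n N) := by
  have hm := measurable_visitTime h.measurable_state h.measurable_mark n
  obtain ⟨γ, δ, hγδ⟩ := h.exists_lintegral_negExp_visitTime_eq hQ hn hN
  refine condDistrib_ae_eq_condDistrib_eval
    (V := fun ω (j : Fin (N + 1)) => visitTime (Y · ω) (W · ω) n j) (by fun_prop) (hm (N + 1))
    (Fin.last N) (g := fun r t => δ r * negExp (γ r * t)) (fun r => by fun_prop) fun r m => ?_
  let a : ℕ → ℝ≥0 := Function.extend Fin.val (fun i => m i) 0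
  have ha (i : ℕ) (hi : N < i) : a i = 0 := by
    refine Function.extend_apply' _ _ _ ?_
    rintro ⟨j, rfl⟩
    exact (Nat.lt_succ_iff.1 j.isLt).not_gt hi
  have hsum (c : ℕ → ℝ≥0∞) :
      ∑ x ∈ Finset.range n, a x * c x = ∑ i : Fin (N + 1), m i * c i := by
    have hvan (x : ℕ) (hx : x ∉ Finset.range (N + 1)) : a x * c x = 0 := by
      rw [ha x (by simpa using hx), ENNReal.coe_zero, zero_mul]
    rw [← Finset.sum_subset (Finset.range_subset_range.2 hN.le) fun x _ => hvan x,
      Finset.sum_range]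
    simp [a, Fin.val_injective.extend_apply]
  simpa only [hsum, ENNReal.coe_natCast, Fin.val_last] using hγδ r a ha

end IsJumpChain

end Law

theorem lemma1 {Ω : Type*} [MeasurableSpace Ω] (P : Measure Ω) [IsProbabilityMeasure P]
    (Q : Matrix ℕ ℕ ℝ) (hQ : IsSkipFreeGenerator Q)
    (X : ℝ≥0 → Ω → ℕ) (hX : IsMarkovJumpProcess P Q 0 X)
    (n : ℕ) (hn : IsTridiagonal (upperLeft Q n)) :
    HasMarkovProperty P n (fun i => occupationTime X n i) := by
  obtain ⟨Y, W, hchain, hpath⟩ := hX.exists_isJumpChain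
  let l (i : ℕ) (ω : Ω) : ℝ≥0∞ := visitTime (Y · ω) (W · ω) n i
  have hl (i : ℕ) : Measurable (l i) :=
    measurable_visitTime hchain.measurable_state hchain.measurable_mark n i
  have hocc : ∀ᵐ ω ∂P, ∀ i, occupationTime X n i ω = l i ω := by
    filter_upwards [hchain.ae_exists_hitsAt hQ hn, hchain.ae_holding_pos hQ, hpath]
      with ω ⟨m, hm⟩ hpos hjump i
    exact hm.occupationTime_eq hjump hpos i
  have hocc' (i : ℕ) : occupationTime X n i =ᵐ[P] l i := hocc.mono fun ω hω => hω i
  refine ⟨fun i _ => ⟨l i, hl i, hocc' i⟩, fun k hk hkn => ?_⟩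
  obtain ⟨N, rfl⟩ := Nat.exists_eq_add_of_le' hk
  rw [Nat.add_sub_cancel, condDistrib_congr (hocc' (N + 1)) (hocc' N),
    condDistrib_congr (hocc' (N + 1)) (X' := fun ω (j : Fin (N + 1)) => l j ω)
      (hocc.mono fun ω hω => funext fun j => hω j)]
  filter_upwards [hchain.condDistrib_visitTime_ae_eq hQ hn hkn, hocc] with ω hω hω'
  simpa only [hω'] using hω
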